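/- Let $X$ be a complex Banach space, $\mathcal B(X)$ the bounded linear operators on $X$ with the operator norm, and $\mathbb N=\{1,2,\dots\}$. Compositions of possibly unbounded operators have the domain $\mathcal D(KA)=\{x\in\mathcal D(A) : Ax\in\mathcal D(K)\}$, and $e^{tA}$ denotes the $C_0$-semigroup with generator $(A,\mathcal D(A))$. Let $(L,\mathcal D(L))$ be the generator of a $C_0$-semigroup $(e^{tL})_{t\ge 0}$ on $X$ with $\|e^{tL}\|\le 1$ for all $t\ge 0$. Let $M,P\in\mathcal B(X)$ with $\|M\|\le 1$ and $P^2=P$, and let $\delta\in(0,1)$ and $\tilde c\ge 0$ be such that $$\|M^n-P\|\le \tilde c\,\delta^n\qquad\text{for all } n\in\mathbb N .$$ Let $b\ge 0$ be such that $$\|Pe^{tL}(1-P)\|\le tb\quad\text{and}\quad \|(1-P)e^{tL}P\|\le tb\qquad\text{for all } t\ge 0 .$$ Assume that $(PLP,\mathcal D(LP))$ is the generator of a $C_0$-semigroup $(e^{tPLP})_{t\ge 0}$ on $X$. Then there is $n_0\in\mathbb N$ with $\tilde\delta:=\tilde c\,\delta^{n_0}<1$. Moreover, for every $n_0\in\mathbb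 N$ with $\tilde\delta:=\tilde c\,\delta^{n_0}<1$, every $t\ge 0$, every $n\in\mathbb N$ and every $x\in\mathcal D((LP)^2)$, $$\bigl\|(M^{n_0}e^{\frac tn L})^n x-e^{tPLP}Px\bigr\|\le \frac{c}{n}\bigl(\|x\|+\|LPx\|+\|(LP)^2x\|\bigr)+\tilde\delta^{\,n}\|x\| ,$$ where the constant $c=c(t,b,\tilde\delta)>0$ depends only on $t$, $b$ and $\tilde\delta$ (not on $X,L,M,P,n,x$, nor otherwise on $\tilde c,\delta,n_0$). -/

import Mathlib

open Filter Topology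

universe u

namespace Zeno

section

variable {X : Type*} [NormedAddCommGroup X] [NormedSpace ℂ X]

/-- A `C₀`-semigroup of bounded operators on `X`. Only the values `T t` with `0 ≤ t` matter. -/
structure IsC0Semigroup (T : ℝ → X →L[ℂ] X) : Prop where
  map_zero : T 0 = 1
  map_add : ∀ s t : ℝ, 0 ≤ s → 0 ≤ t → T (s + t) = T s * T t
  tendsto_zero : ∀ x : X, Tendsto (fun t : ℝ => T t x) (𝓝[>] 0) (𝓝 x)

/-- The generator of `T`: `x` lies in the domain iff `(T h x - x) / h` converges as `h ↓ 0`,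
and the value at `x` is the limit. -/
noncomputable def generator (T : ℝ → X →L[ℂ] X) : X →ₗ.[ℂ] X where
  domain :=
    { carrier := {x | ∃ y : X, Tendsto (fun h : ℝ => h⁻¹ • (T h x - x)) (𝓝[>] 0) (𝓝 y)}
      zero_mem' := ⟨0, by simp⟩
      add_mem' := by
        rintro x x' ⟨y, hy⟩ ⟨y', hy'⟩
        refine ⟨y + y', (hy.add hy').congr fun h => ?_⟩
        rw [← smul_add, map_add]
        congr 1
        abel
      smul_mem' := by
        rintro a x ⟨y, hy⟩
        refine ⟨a • y, (hy.const_smul a).congr fun h => ?_⟩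
        rw [map_smul, ← smul_sub, smul_comm] }
  toFun :=
    { toFun := fun x => x.2.choose
      map_add' := by
        intro x x'
        refine tendsto_nhds_unique (x + x').2.choose_spec
          ((x.2.choose_spec.add x'.2.choose_spec).congr fun h => ?_)
        rw [← smul_add, Submodule.coe_add, map_add]
        congr 1
        abel
      map_smul' := by
        intro a x
        refine tendsto_nhds_unique (a • x).2.choose_spec
          ((x.2.choose_spec.const_smul a).congr fun h => ?_)
        rw [Submodule.coe_smul, map_smul, ← smul_sub, smul_comm] }

theorem mem_generator_domain_iff (T : ℝ → X →L[ℂ] X) (x : X) :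
    x ∈ (generator T).domain ↔
      ∃ y : X, Tendsto (fun h : ℝ => h⁻¹ • (T h x - x)) (𝓝[>] 0) (𝓝 y) :=
  Iff.rfl

theorem tendsto_generator (T : ℝ → X →L[ℂ] X) (x : (generator T).domain) :
    Tendsto (fun h : ℝ => h⁻¹ • (T h x - (x : X))) (𝓝[>] 0) (𝓝 (generator T x)) :=
  x.2.choose_spec

/-- `A` (with its domain) is the generator of the `C₀`-semigroup `T`, i.e. `T t = exp (t A)`. -/
def IsGeneratorOf (A : X →ₗ.[ℂ] X) (T : ℝ → X →L[ℂ] X) : Prop :=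
  IsC0Semigroup T ∧ A = generator T

/-- The composition `K A` of unbounded operators, on `D(K A) = {x ∈ D(A) | A x ∈ D(K)}`. -/
def pcomp (K A : X →ₗ.[ℂ] X) : X →ₗ.[ℂ] X where
  domain :=
    { carrier := {x | ∃ hx : x ∈ A.domain, A ⟨x, hx⟩ ∈ K.domain}
      zero_mem' := ⟨A.domain.zero_mem, by
        have h : A ⟨0, A.domain.zero_mem⟩ = 0 := A.map_zero
        rw [h]
        exact K.domain.zero_mem⟩
      add_mem' := by
        rintro x y ⟨hx, hx'⟩ ⟨hy, hy'⟩
        refine ⟨A.domain.add_mem hx hy, ?_⟩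
        have h : A ⟨x + y, A.domain.add_mem hx hy⟩ = A ⟨x, hx⟩ + A ⟨y, hy⟩ :=
          A.map_add ⟨x, hx⟩ ⟨y, hy⟩
        rw [h]
        exact K.domain.add_mem hx' hy'
      smul_mem' := by
        rintro a x ⟨hx, hx'⟩
        refine ⟨A.domain.smul_mem a hx, ?_⟩
        have h : A ⟨a • x, A.domain.smul_mem a hx⟩ = a • A ⟨x, hx⟩ := A.map_smul a ⟨x, hx⟩
        rw [h]
        exact K.domain.smul_mem a hx' }
  toFun :=
    { toFun := fun x => K ⟨A ⟨x, x.2.fst⟩, x.2.snd⟩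
      map_add' := by
        intro x y
        rw [← K.map_add]
        congr 1
        exact Subtype.ext (A.map_add ⟨x, x.2.fst⟩ ⟨y, y.2.fst⟩)
      map_smul' := by
        intro a x
        rw [RingHom.id_apply, ← K.map_smul]
        congr 1
        exact Subtype.ext (A.map_smul a ⟨x, x.2.fst⟩) }

theorem mem_pcomp_domain_iff (K A : X →ₗ.[ℂ] X) (x : X) :
    x ∈ (pcomp K A).domain ↔ ∃ hx : x ∈ A.domain, A ⟨x, hx⟩ ∈ K.domain :=
  Iff.rfl

theorem pcomp_domain_le (K A : X →ₗ.[ℂ] X) : (pcomp K A).domain ≤ A.domain :=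
  fun _ hx => hx.fst

/-- A bounded operator, regarded as an operator with domain all of `X`. -/
def ofBounded (P : X →L[ℂ] X) : X →ₗ.[ℂ] X :=
  (P : X →ₗ[ℂ] X).toPMap ⊤

/-- `L P`, with domain `{x | P x ∈ D(L)}`. -/
def LP (L : X →ₗ.[ℂ] X) (P : X →L[ℂ] X) : X →ₗ.[ℂ] X :=
  pcomp L (ofBounded P)

/-- `P L P`, with domain `D(L P)`. -/
def PLP (L : X →ₗ.[ℂ] X) (P : X →L[ℂ] X) : X →ₗ.[ℂ] X :=
  pcomp (ofBounded P) (LP L P)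

/-- `(L P)²`, with domain `{x ∈ D(L P) | L P x ∈ D(L P)}`. -/
def LPsq (L : X →ₗ.[ℂ] X) (P : X →L[ℂ] X) : X →ₗ.[ℂ] X :=
  pcomp (LP L P) (LP L P)

theorem LPsq_domain_le (L : X →ₗ.[ℂ] X) (P : X →L[ℂ] X) :
    (LPsq L P).domain ≤ (LP L P).domain :=
  pcomp_domain_le _ _

end

end Zeno

/-! Put `N = M ^ n₀`, `U = T (t / n)` and split `N * U = A + B` with `A = P * U`, `B = (N - P) * U`.
As `N * P = P * N = P`, the factor `N - P` lives on the complement of `P`. Hence every passage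
between `A` and `B` in the expanded power carries an off-diagonal block of `U`, of size `e = t * b /
n`, while every `B` costs `d = c' * δ ^ n₀`. Words with one crossing sum to `O(e)`, words that
return to `A` to `O(n * e ^ 2)`, and the pure word `B ^ n` gives `d ^ n`; so `(N * U) ^ n` is within
`O(1 / n) + d ^ n` of `(P * U) ^ n` (`norm_zeno_sub_le`). It remains to compare `(P * U) ^ n` with
`S t` on `P x`. Both have the Taylor expansion `u + s • P L u + O(s ^ 2)` on the range of `P`, both
are contractive there on the vectors that occur, and telescoping over `n` steps of length `t / n`
leaves `O(1 / n)` (`norm_pow_apply_sub_le`). -/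

namespace Zeno

/-! ### Noncommutative binomial estimates. -/

section Binomial

variable {R : Type*} [NormedRing R] {A B : R} {d e : ℝ}

/-- Expand the factor next to `B ^ j * A`: choosing `A` returns and costs `e ^ 2 * d ^ j`, choosing
`B` raises `j`. The returns form a geometric series; the word that never returns leaves `d ^ (j + m)
* e`. -/
theorem norm_add_pow_mul_pow_mul_le (hd0 : 0 ≤ d) (hd1 : d < 1)
    (hAB : ∀ m : ℕ, ‖(A + B) ^ m‖ ≤ 1)
    (hBA : ∀ j : ℕ, 1 ≤ j → ‖B ^ j * A‖ ≤ d ^ j * e)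
    (hABA : ∀ j : ℕ, 1 ≤ j → ‖A * (B ^ j * A)‖ ≤ e ^ 2 * d ^ j) (m : ℕ) :
    ∀ j : ℕ, 1 ≤ j →
      ‖(A + B) ^ m * (B ^ j * A)‖ ≤ e ^ 2 * (d ^ j / (1 - d)) + d ^ (j + m) * e := by
  have hd : 0 < 1 - d := by linarith
  induction m with
  | zero =>
    intro j hj
    have h := hBA j hj
    have : 0 ≤ e ^ 2 * (d ^ j / (1 - d)) := by positivity
    simp only [pow_zero, one_mul, add_zero]
    linarith
  | succ m ih =>
    intro j hj
    have h1 : (A + B) ^ (m + 1) * (B ^ j * A)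
        = (A + B) ^ m * (A * (B ^ j * A)) + (A + B) ^ m * (B ^ (j + 1) * A) := by
      rw [pow_succ (A + B) m, pow_succ' B j]; noncomm_ring
    have h2 : ‖(A + B) ^ m * (A * (B ^ j * A))‖ ≤ e ^ 2 * d ^ j :=
      calc _ ≤ ‖(A + B) ^ m‖ * ‖A * (B ^ j * A)‖ := norm_mul_le _ _
        _ ≤ 1 * (e ^ 2 * d ^ j) := by
          gcongr
          · exact hAB m
          · exact hABA j hj
        _ = _ := one_mul _
    have h3 := ih (j + 1) (by omega)
    have h4 : e ^ 2 * (d ^ j / (1 - d)) = e ^ 2 * d ^ j + e ^ 2 * (d ^ (j + 1) / (1 - d)) := by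
      field_simp; ring
    rw [h1, h4, show j + (m + 1) = j + 1 + m by ring]
    exact (norm_add_le _ _).trans (by linarith)

/-- The prefix `(A + B) ^ m` is what makes the induction work: bounding each `B * A ^ (n + 1)` alone
by `d * e` would total `n * e`, which does not vanish for `e` of order `1 / n`. Behind the prefix,
the part linear in `e` decays like `d ^ (m + 1)` and is summable; only `e ^ 2` accumulates `n`
times. -/
theorem norm_add_pow_mul_add_pow_sub_le (hd0 : 0 ≤ d) (hd1 : d < 1)
    (hA : ∀ m : ℕ, ‖A ^ m‖ ≤ 1)
    (hAB : ∀ m : ℕ, ‖(A + B) ^ m‖ ≤ 1)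
    (hAB' : ∀ j : ℕ, 1 ≤ j → ‖A * B ^ j‖ ≤ e * d ^ j)
    (hBA : ∀ j : ℕ, 1 ≤ j → ‖B ^ j * A‖ ≤ d ^ j * e)
    (hABA : ∀ j : ℕ, 1 ≤ j → ‖A * (B ^ j * A)‖ ≤ e ^ 2 * d ^ j) (n : ℕ) (m : ℕ) (he : 0 ≤ e) :
      ‖(A + B) ^ m * ((A + B) ^ (n + 1) - A ^ (n + 1) - B ^ (n + 1))‖ ≤
        e * ((1 - d ^ (n + 1)) / (1 - d)) + n * (e ^ 2 / (1 - d))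
          + e * (d ^ (m + 1) / (1 - d)) := by
  have hd : 0 < 1 - d := by linarith
  induction n generalizing m with
  | zero =>
    simp only [zero_add, pow_one, add_sub_cancel_left, sub_self, mul_zero, norm_zero]
    rw [div_self hd.ne']
    positivity
  | succ n ih =>
    have h1 : (A + B) ^ m * ((A + B) ^ (n + 1 + 1) - A ^ (n + 1 + 1) - B ^ (n + 1 + 1))
        = (A + B) ^ (m + 1) * ((A + B) ^ (n + 1) - A ^ (n + 1) - B ^ (n + 1))
          + (A + B) ^ m * (A * B ^ (n + 1)) + (A + B) ^ m * (B ^ 1 * A) * A ^ n := by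
      rw [pow_succ' (A + B) (n + 1), pow_succ' A (n + 1), pow_succ' B (n + 1),
        pow_succ (A + B) m, pow_one, pow_succ' A n]
      noncomm_ring
    have h2 : ‖(A + B) ^ m * (A * B ^ (n + 1))‖ ≤ e * d ^ (n + 1) :=
      calc _ ≤ ‖(A + B) ^ m‖ * ‖A * B ^ (n + 1)‖ := norm_mul_le _ _
        _ ≤ 1 * (e * d ^ (n + 1)) := by
          gcongr
          · exact hAB m
          · exact hAB' _ (by omega)
        _ = _ := one_mul _
    have h3 : ‖(A + B) ^ m * (B ^ 1 * A) * A ^ n‖ ≤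
        e ^ 2 * (d ^ 1 / (1 - d)) + d ^ (1 + m) * e :=
      calc _ ≤ ‖(A + B) ^ m * (B ^ 1 * A)‖ * ‖A ^ n‖ := norm_mul_le _ _
        _ ≤ (e ^ 2 * (d ^ 1 / (1 - d)) + d ^ (1 + m) * e) * 1 := by
          gcongr
          · exact norm_add_pow_mul_pow_mul_le hd0 hd1 hAB hBA hABA m 1 le_rfl
          · exact hA n
        _ = _ := mul_one _
    have h4 : e ^ 2 * (d ^ 1 / (1 - d)) ≤ e ^ 2 / (1 - d) := by
      rw [← mul_div_assoc, pow_one]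
      gcongr
      nlinarith [sq_nonneg e]
    have h5 : e * ((1 - d ^ (n + 1 + 1)) / (1 - d))
        = e * ((1 - d ^ (n + 1)) / (1 - d)) + e * d ^ (n + 1) := by
      field_simp; ring
    have h6 : e * (d ^ (m + 1) / (1 - d))
        = e * (d ^ (m + 1 + 1) / (1 - d)) + d ^ (1 + m) * e := by
      field_simp; ring
    have h7 := ih (m + 1)
    rw [h1, h5, h6]
    push_cast
    have h8 := norm_add₃_le (a := (A + B) ^ (m + 1) * ((A + B) ^ (n + 1) - A ^ (n + 1) - B ^ (n + 1)))
      (b := (A + B) ^ m * (A * B ^ (n + 1))) (c := (A + B) ^ m * (B ^ 1 * A) * A ^ n)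
    linarith

end Binomial

/-! ### Orbits of a `C₀`-semigroup and Taylor estimates. -/

section Semigroup

variable {X : Type*} [NormedAddCommGroup X] [NormedSpace ℂ X]

/-- `x` lies in the domain of the generator of `T`, which takes the value `y` at `x`. -/
def HasGen (T : ℝ → X →L[ℂ] X) (x y : X) : Prop :=
  Tendsto (fun h : ℝ => h⁻¹ • (T h x - x)) (𝓝[>] 0) (𝓝 y)

variable {T : ℝ → X →L[ℂ] X} {x y : X}

theorem hasGen_iff :
    HasGen T x y ↔ ∃ hx : x ∈ (generator T).domain, generator T ⟨x, hx⟩ = y := by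
  constructor
  · intro h
    exact ⟨⟨y, h⟩, tendsto_nhds_unique (tendsto_generator T ⟨x, ⟨y, h⟩⟩) h⟩
  · rintro ⟨hx, rfl⟩
    exact tendsto_generator T ⟨x, hx⟩

theorem clm_real_smul (P : X →L[ℂ] X) (r : ℝ) (x : X) : P (r • x) = r • P x :=
  (P.restrictScalars ℝ).map_smul r x

theorem HasGen.apply (hT : IsC0Semigroup T) (h : HasGen T x y) {t : ℝ} (ht : 0 ≤ t) :
    HasGen T (T t x) (T t y) := by
  refine (((T t).continuous.tendsto y).comp h).congr' ?_
  filter_upwards [self_mem_nhdsWithin] with s hs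
  have hs : 0 ≤ s := le_of_lt hs
  have h1 : T s (T t x) = T t (T s x) := by
    rw [← mul_apply_eq_comp, ← mul_apply_eq_comp,
      ← hT.map_add s t hs ht, ← hT.map_add t s ht hs, add_comm]
  simp only [Function.comp, h1, clm_real_smul, map_sub]

theorem apply_add (hT : IsC0Semigroup T) {s t : ℝ} (hs : 0 ≤ s) (ht : 0 ≤ t) (x : X) :
    T (s + t) x = T s (T t x) := by
  rw [hT.map_add s t hs ht]; rfl

/-- Right derivatives suffice: the mean value inequalities below need only these and continuity. -/
theorem HasGen.hasDerivWithinAt (hT : IsC0Semigroup T) (h : HasGen T x y) {t : ℝ} (ht : 0 ≤ t) :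
    HasDerivWithinAt (fun r => T r x) (T t y) (Set.Ici t) t := by
  rw [← hasDerivWithinAt_Ioi_iff_Ici, hasDerivWithinAt_iff_tendsto_slope' (by simp)]
  have h1 : Tendsto (fun r : ℝ => r - t) (𝓝[>] t) (𝓝[>] 0) := by
    refine tendsto_nhdsWithin_iff.2 ⟨?_, ?_⟩
    · have : Tendsto (fun r : ℝ => r - t) (𝓝 t) (𝓝 (t - t)) :=
        (continuous_id.sub continuous_const).tendsto t
      rw [sub_self] at this
      exact this.mono_left nhdsWithin_le_nhds
    · filter_upwards [self_mem_nhdsWithin] with r hr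
      simpa using hr
  refine ((h.apply hT ht).comp h1).congr' ?_
  filter_upwards [self_mem_nhdsWithin] with r hr
  have hr : t < r := hr
  simp only [Function.comp, slope, vsub_eq_sub]
  rw [← apply_add hT (by linarith) ht, sub_add_cancel]

variable [CompleteSpace X]

/-- Otherwise the norms blow up along some `t n → 0`, while every orbit converges there, against
Banach–Steinhaus. This is needed for `S`, which is not assumed bounded. -/
theorem exists_norm_le_near_zero (hT : IsC0Semigroup T) :
    ∃ a > 0, ∃ K, 1 ≤ K ∧ ∀ t, 0 ≤ t → t ≤ a → ‖T t‖ ≤ K := by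
  by_contra! hcon
  have h1 : ∀ n : ℕ, ∃ t : ℝ, 0 ≤ t ∧ t ≤ 1 / ((n : ℝ) + 1) ∧ (n : ℝ) + 1 < ‖T t‖ := fun n =>
    hcon (1 / ((n : ℝ) + 1)) (by positivity) (n + 1) (by linarith [n.cast_nonneg (α := ℝ)])
  choose t ht0 ht1 ht2 using h1
  have htl : Tendsto t atTop (𝓝 0) :=
    squeeze_zero ht0 ht1 tendsto_one_div_add_atTop_nhds_zero_nat
  have hb : ∀ x : X, ∃ C, ∀ n, ‖T (t n) x‖ ≤ C := by
    intro x
    have h2 : Tendsto (fun r => T r x) (𝓝[≥] 0) (𝓝 x) := by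
      rw [← Set.Ioi_insert, nhdsWithin_insert]
      refine Tendsto.sup ?_ (hT.tendsto_zero x)
      rw [tendsto_pure_left]
      intro s hs
      rw [hT.map_zero]
      exact mem_of_mem_nhds hs
    have h3 : Tendsto (fun n => ‖T (t n) x‖) atTop (𝓝 ‖x‖) :=
      (h2.comp (tendsto_nhdsWithin_iff.2 ⟨htl, Eventually.of_forall ht0⟩)).norm
    obtain ⟨C, hC⟩ := h3.bddAbove_range
    exact ⟨C, fun n => hC ⟨n, rfl⟩⟩
  obtain ⟨C, hC⟩ := banach_steinhaus hb
  obtain ⟨n, hn⟩ := exists_nat_gt C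
  linarith [hC n, ht2 n]

theorem exists_norm_le_Icc (hT : IsC0Semigroup T) (b : ℝ) :
    ∃ K, 0 ≤ K ∧ ∀ t, 0 ≤ t → t ≤ b → ‖T t‖ ≤ K := by
  obtain ⟨a, ha, K, hK, h⟩ := exists_norm_le_near_zero hT
  have h1 : ∀ n : ℕ, ∀ t, 0 ≤ t → t ≤ (n + 1) * a → ‖T t‖ ≤ K ^ (n + 1) := by
    intro n
    induction n with
    | zero => intro t ht0 ht1; simpa using h t ht0 (by simpa using ht1)
    | succ n ih =>
      intro t ht0 ht1
      push_cast at ht1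
      by_cases hta : t ≤ (n + 1) * a
      · exact (ih t ht0 hta).trans (pow_le_pow_right₀ hK (by omega))
      · push Not at hta
        have hn : 0 ≤ (n : ℝ) * a := by positivity
        have h2 : T t = T (t - a) * T a := by
          rw [← hT.map_add _ _ (by linarith) ha.le, sub_add_cancel]
        rw [h2, pow_succ]
        refine (norm_mul_le _ _).trans ?_
        gcongr
        · exact ih _ (by linarith) (by linarith)
        · exact h a ha.le le_rfl
  obtain ⟨n, hn⟩ := exists_nat_gt (b / a)
  rw [div_lt_iff₀ ha] at hn
  exact ⟨K ^ (n + 1), by positivity, fun t ht0 htb => h1 n t ht0 (by linarith)⟩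

/-- Factoring out the earlier operator bounds an increment by `K * ‖T |r - t| x - x‖`, with `K`
uniform on the interval; this treats left and right limits together. -/
theorem continuousOn_apply_of_hasGen (hT : IsC0Semigroup T) (h : HasGen T x y) (b : ℝ) :
    ContinuousOn (fun r => T r x) (Set.Icc 0 b) := by
  obtain ⟨K, hK0, hK⟩ := exists_norm_le_Icc hT b
  have hx : Tendsto (fun r => T r x) (𝓝[≥] 0) (𝓝 (T 0 x)) :=
    (h.hasDerivWithinAt hT le_rfl).continuousWithinAt
  rw [hT.map_zero, one_apply_eq_self] at hx
  have key : ∀ s t, 0 ≤ s → s ≤ t → t ≤ b → ‖T t x - T s x‖ ≤ K * ‖T (t - s) x - x‖ := by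
    intro s t hs hst htb
    have : T t x - T s x = T s (T (t - s) x - x) := by
      rw [map_sub, ← apply_add hT hs (by linarith), add_sub_cancel]
    rw [this]
    exact ((T s).le_opNorm _).trans (by gcongr; exact hK s hs (hst.trans htb))
  intro t ht
  rw [ContinuousWithinAt, tendsto_iff_norm_sub_tendsto_zero]
  have h1 : Tendsto (fun r : ℝ => |r - t|) (𝓝[Set.Icc 0 b] t) (𝓝[≥] 0) := by
    refine tendsto_nhdsWithin_iff.2 ⟨?_, Eventually.of_forall fun r => Set.mem_Ici.2 (abs_nonneg _)⟩
    have : Tendsto (fun r : ℝ => |r - t|) (𝓝 t) (𝓝 |t - t|) :=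
      (continuous_id.sub continuous_const).abs.tendsto t
    rw [sub_self, abs_zero] at this
    exact this.mono_left nhdsWithin_le_nhds
  have h2 : Tendsto (fun r : ℝ => K * ‖T |r - t| x - x‖) (𝓝[Set.Icc 0 b] t) (𝓝 0) := by
    have := (((hx.comp h1).sub_const x).norm).const_mul K
    simpa using this
  refine squeeze_zero' (Eventually.of_forall fun r => norm_nonneg _) ?_ h2
  filter_upwards [self_mem_nhdsWithin] with r hr
  rcases le_total r t with hrt | hrt
  · rw [abs_of_nonpos (by linarith), neg_sub, norm_sub_rev]
    exact key r t hr.1 hrt ht.2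
  · rw [abs_of_nonneg (by linarith)]
    exact key t r ht.1 hrt hr.2

theorem norm_apply_sub_le (hT : IsC0Semigroup T) (h : HasGen T x y) {C : ℝ} {t : ℝ} (ht : 0 ≤ t)
    (hC : ∀ r, 0 ≤ r → ‖T r y‖ ≤ C) : ‖T t x - x‖ ≤ t * C := by
  have := image_norm_le_of_norm_deriv_right_le_deriv_boundary
    (f := fun r => T r x - x) (f' := fun r => T r y) (a := 0) (b := t)
    (B := fun r => r * C) (B' := fun _ => C)
    ((continuousOn_apply_of_hasGen hT h t).sub continuousOn_const)
    (fun r hr => (h.hasDerivWithinAt hT hr.1).sub_const x)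
    (by simp [hT.map_zero])
    (fun r => by simpa using (hasDerivAt_id r).mul_const C)
    (fun r hr => hC r hr.1)
  exact this ⟨ht, le_rfl⟩

/-- Second-order Taylor estimate for `B T(t) x`, with `B` a bounded operator. -/
theorem norm_comp_apply_sub_sub_le (hT : IsC0Semigroup T) (h : HasGen T x y) (B : X →L[ℂ] X)
    (w : X) {C : ℝ} {t : ℝ} (ht : 0 ≤ t) (hC : ∀ r, 0 ≤ r → ‖B (T r y) - w‖ ≤ r * C) :
    ‖B (T t x) - B x - t • w‖ ≤ t ^ 2 / 2 * C := by
  have := image_norm_le_of_norm_deriv_right_le_deriv_boundary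
    (f := fun r => B (T r x) - B x - r • w) (f' := fun r => B (T r y) - w) (a := 0) (b := t)
    (B := fun r => r ^ 2 / 2 * C) (B' := fun r => r * C)
    (((B.continuous.comp_continuousOn (continuousOn_apply_of_hasGen hT h t)).sub
      continuousOn_const).sub (by fun_prop))
    (fun r hr => by
      have h1 := ((B.restrictScalars ℝ).hasFDerivAt (x := T r x)).comp_hasDerivWithinAt r
        (h.hasDerivWithinAt hT hr.1)
      have h2 := (hasDerivWithinAt_id r (Set.Ici r)).smul_const w
      have h3 := (h1.sub_const (B x)).sub h2
      rw [one_smul] at h3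
      exact h3)
    (by simp [hT.map_zero])
    (fun r => by
      have := ((hasDerivAt_pow 2 r).div_const 2).mul_const C
      simpa using this)
    (fun r hr => hC r hr.1)
  exact this ⟨ht, le_rfl⟩

end Semigroup
end Zeno
namespace Zeno

/-! ### The compressed semigroup on the range of `P`. -/

section Projected

variable {X : Type*} [NormedAddCommGroup X] [NormedSpace ℂ X]
  {T S : ℝ → X →L[ℂ] X} {P : X →L[ℂ] X} {b : ℝ} {u w : X}

/-- `S` is generated by `P A P`, where `A` is the generator of `T`. -/
def IsCompressedGen (T S : ℝ → X →L[ℂ] X) (P : X →L[ℂ] X) : Prop :=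
  ∀ x z : X, HasGen S x z ↔ ∃ y, HasGen T (P x) y ∧ z = P y

/-- Divide the off-diagonal bound by `t` and let `t ↓ 0`; since `(1 - P) u = 0`, the quotients tend
to `(1 - P) y`. -/
theorem norm_sub_proj_le (hQTP : ∀ t : ℝ, 0 ≤ t → ‖(1 - P) * T t * P‖ ≤ t * b)
    (hu : P u = u) {y : X} (h : HasGen T u y) : ‖y - P y‖ ≤ b * ‖u‖ := by
  have h1 := (((1 - P : X →L[ℂ] X).continuous.tendsto y).comp h).norm
  refine le_of_tendsto h1 ?_
  filter_upwards [self_mem_nhdsWithin] with s hs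
  have hs : 0 < s := hs
  have h2 : (1 - P) (s⁻¹ • (T s u - u)) = s⁻¹ • ((1 - P) * T s * P) u := by
    rw [clm_real_smul, map_sub]
    congr 1
    simp [mul_apply_eq_comp, hu]
  simp only [Function.comp, h2]
  rw [norm_smul, norm_inv, Real.norm_of_nonneg hs.le]
  calc s⁻¹ * ‖((1 - P) * T s * P) u‖ ≤ s⁻¹ * (s * b * ‖u‖) := by
        gcongr
        exact ContinuousLinearMap.le_of_opNorm_le _ (hQTP s hs.le) u
    _ = b * ‖u‖ := by field_simp

variable [CompleteSpace X]

/-- The generator of `S` takes values in the range of `P`, so `P (S r u) - S r u` has zero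
derivative and starts at zero. -/
theorem proj_apply_of_hasGen (hS : IsC0Semigroup S) (hP : P * P = P) (hc : IsCompressedGen T S P)
    (hu : P u = u) (h : HasGen S u w) {t : ℝ} (ht : 0 ≤ t) : P (S t u) = S t u := by
  have hcont := continuousOn_apply_of_hasGen hS h t
  have := image_norm_le_of_norm_deriv_right_le_deriv_boundary
    (f := fun r => P (S r u) - S r u) (f' := fun r => P (S r w) - S r w) (a := 0) (b := t)
    (B := fun _ => 0) (B' := fun _ => 0)
    ((P.continuous.comp_continuousOn hcont).sub hcont)
    (fun r hr => by
      have h0 := h.hasDerivWithinAt hS hr.1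
      have h1 := ((P.restrictScalars ℝ).hasFDerivAt (x := S r u)).comp_hasDerivWithinAt r h0
      exact h1.sub h0)
    (by simp [hS.map_zero, hu])
    (fun r => hasDerivAt_const _ _)
    (fun r hr => by
      obtain ⟨y, -, hy⟩ := (hc _ _).1 (h.apply hS hr.1)
      rw [hy, ← mul_apply_eq_comp, hP]
      simp)
  exact sub_eq_zero.1 (norm_le_zero_iff.1 (this ⟨ht, le_rfl⟩))

/-- At `v = S r u`, the curves `S s v` and `P (T s v)` have the same right derivative at `s = 0`,
and `P * T s` is a contraction. So the upper right derivative of `‖S r u‖` is at most zero. -/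
theorem norm_apply_le_of_hasGen (hS : IsC0Semigroup S) (hTc : ∀ t : ℝ, 0 ≤ t → ‖T t‖ ≤ 1)
    (hP : P * P = P) (hP1 : ‖P‖ ≤ 1) (hc : IsCompressedGen T S P)
    (hu : P u = u) (h : HasGen S u w) {t : ℝ} (ht : 0 ≤ t) : ‖S t u‖ ≤ ‖u‖ := by
  refine image_le_of_liminf_slope_right_le_deriv_boundary
    (f := fun r => ‖S r u‖) (a := 0) (b := t) (B := fun _ => ‖u‖) (B' := fun _ => 0)
    (continuousOn_apply_of_hasGen hS h t).norm (by simp [hS.map_zero]) continuousOn_const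
    (fun r _ => hasDerivWithinAt_const _ _ _) ?_ ⟨ht, le_rfl⟩
  intro r hr ε hε
  have hr0 : 0 ≤ r := hr.1
  have hSr := h.apply hS hr0
  have hPv : P (S r u) = S r u := proj_apply_of_hasGen hS hP hc hu h hr0
  obtain ⟨y, hy, hwy⟩ := (hc _ _).1 hSr
  rw [hPv] at hy
  have h1 : Tendsto (fun s : ℝ => ‖s⁻¹ • (S s (S r u) - S r u)
      - P (s⁻¹ • (T s (S r u) - S r u))‖) (𝓝[>] 0) (𝓝 0) := by
    have := (hSr.sub ((P.continuous.tendsto y).comp hy)).norm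
    rwa [hwy, sub_self, norm_zero] at this
  have h2 : Tendsto (fun z : ℝ => z - r) (𝓝[>] r) (𝓝[>] 0) := by
    refine tendsto_nhdsWithin_iff.2 ⟨?_, ?_⟩
    · have : Tendsto (fun z : ℝ => z - r) (𝓝 r) (𝓝 (r - r)) :=
        (continuous_id.sub continuous_const).tendsto r
      rw [sub_self] at this
      exact this.mono_left nhdsWithin_le_nhds
    · filter_upwards [self_mem_nhdsWithin] with z hz
      simpa using hz
  refine Eventually.frequently ?_
  filter_upwards [(h1.comp h2).eventually (gt_mem_nhds hε), self_mem_nhdsWithin] with z hz hzr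
  have hzr : 0 < z - r := sub_pos.2 hzr
  refine lt_of_le_of_lt ?_ hz
  simp only [Function.comp, slope, vsub_eq_sub, smul_eq_mul]
  have h3 : S z u = S (z - r) (S r u) := by rw [← apply_add hS hzr.le hr0, sub_add_cancel]
  have h4 : (z - r)⁻¹ • (S (z - r) (S r u) - S r u) - P ((z - r)⁻¹ • (T (z - r) (S r u) - S r u))
      = (z - r)⁻¹ • (S (z - r) (S r u) - P (T (z - r) (S r u))) := by
    rw [clm_real_smul, ← smul_sub, map_sub, hPv]
    congr 1
    abel
  have h5 : ‖P (T (z - r) (S r u))‖ ≤ ‖S r u‖ := by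
    have h6 := ContinuousLinearMap.le_of_opNorm_le _ hP1 (T (z - r) (S r u))
    have h7 := ContinuousLinearMap.le_of_opNorm_le _ (hTc _ hzr.le) (S r u)
    linarith
  rw [h3, h4, norm_smul, norm_inv, Real.norm_of_nonneg hzr.le]
  gcongr
  have := norm_sub_norm_le (S (z - r) (S r u)) (P (T (z - r) (S r u)))
  linarith

/-- The contraction bound extends to values of the generator. -/
theorem norm_apply_gen_le (hS : IsC0Semigroup S) (hTc : ∀ t : ℝ, 0 ≤ t → ‖T t‖ ≤ 1)
    (hP : P * P = P) (hP1 : ‖P‖ ≤ 1) (hc : IsCompressedGen T S P)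
    (hu : P u = u) (h : HasGen S u w) {t : ℝ} (ht : 0 ≤ t) : ‖S t w‖ ≤ ‖w‖ := by
  -- `w` need not lie in the domain, but the difference quotients converging to it do, and they lie
  -- in the range of `P`.
  refine le_of_tendsto_of_tendsto (((S t).continuous.tendsto w).comp h).norm h.norm ?_
  filter_upwards [self_mem_nhdsWithin] with s hs
  have hs : 0 ≤ s := le_of_lt hs
  simp only [Function.comp, clm_real_smul, norm_smul]
  gcongr
  have h1 : HasGen S (S s u - u) (S s w - w) := by
    refine ((h.apply hS hs).sub h).congr fun r => ?_
    rw [← smul_sub, map_sub]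
    congr 1
    abel
  exact norm_apply_le_of_hasGen hS hTc hP hP1 hc
    (by rw [map_sub, proj_apply_of_hasGen hS hP hc hu h hs, hu]) h1 ht

theorem norm_proj_apply_sub_sub_le (hT : IsC0Semigroup T) (hTc : ∀ t : ℝ, 0 ≤ t → ‖T t‖ ≤ 1)
    (hP1 : ‖P‖ ≤ 1) (hb : 0 ≤ b)
    (hPTQ : ∀ t : ℝ, 0 ≤ t → ‖P * T t * (1 - P)‖ ≤ t * b)
    (hQTP : ∀ t : ℝ, 0 ≤ t → ‖(1 - P) * T t * P‖ ≤ t * b)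
    (hP : P * P = P) (hc : IsCompressedGen T S P) {v : X}
    (hu : P u = u) (h : HasGen S u w) (h' : HasGen S w v) {t : ℝ} (ht : 0 ≤ t) :
    ‖P (T t u) - u - t • w‖ ≤ t ^ 2 / 2 * (b ^ 2 * ‖u‖ + b * ‖w‖ + ‖v‖) := by
  obtain ⟨y, hy, rfl⟩ := (hc _ _).1 h
  have hPP : ∀ z, P (P z) = P z := fun z => by rw [← mul_apply_eq_comp, hP]
  obtain ⟨y', hy', rfl⟩ := (hc _ _).1 h'
  rw [hu] at hy
  rw [hPP] at hy'
  have h1 := norm_sub_proj_le hQTP hu hy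
  have h2 := norm_sub_proj_le hQTP (hPP y) hy'
  have h3 : ‖y'‖ ≤ b * ‖P y‖ + ‖P y'‖ := by
    have := norm_add_le (y' - P y') (P y')
    rw [sub_add_cancel] at this
    linarith
  have key : ∀ r, 0 ≤ r →
      ‖P (T r y) - P y‖ ≤ r * (b ^ 2 * ‖u‖ + b * ‖P y‖ + ‖P y'‖) := by
    intro r hr
    -- `y` itself need not be in the domain, but `P y` is. The complementary part of `y` has norm at
    -- most `b * ‖u‖` and re-enters the range of `P` only through a block of size `r * b`, so it too
    -- contributes `O(r)`.
    have e1 : P (T r y) - P y = (P * T r * (1 - P)) (y - P y) + P (T r (P y) - P y) := by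
      simp [mul_apply_eq_comp, hPP]
    have e2 : ‖(P * T r * (1 - P)) (y - P y)‖ ≤ r * b * (b * ‖u‖) :=
      (ContinuousLinearMap.le_of_opNorm_le _ (hPTQ r hr) _).trans (by gcongr)
    have e3 : ‖T r (P y) - P y‖ ≤ r * ‖y'‖ := norm_apply_sub_le hT hy' hr fun q hq => by
      simpa using ContinuousLinearMap.le_of_opNorm_le _ (hTc q hq) y'
    have e4 : ‖P (T r (P y) - P y)‖ ≤ r * ‖y'‖ := by
      have := ContinuousLinearMap.le_of_opNorm_le _ hP1 (T r (P y) - P y)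
      linarith
    have e5 : r * ‖y'‖ ≤ r * (b * ‖P y‖ + ‖P y'‖) := by gcongr
    rw [e1]
    refine (norm_add_le _ _).trans ?_
    nlinarith
  have := norm_comp_apply_sub_sub_le hT hy P (P y) ht key
  rwa [hu] at this

theorem norm_compressed_apply_sub_sub_le (hS : IsC0Semigroup S)
    (hTc : ∀ t : ℝ, 0 ≤ t → ‖T t‖ ≤ 1)
    (hP : P * P = P) (hP1 : ‖P‖ ≤ 1) (hc : IsCompressedGen T S P) {v : X}
    (hw : P w = w) (h : HasGen S u w) (h' : HasGen S w v) {t : ℝ} (ht : 0 ≤ t) :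
    ‖S t u - u - t • w‖ ≤ t ^ 2 / 2 * ‖v‖ :=
  norm_comp_apply_sub_sub_le hS h 1 w ht fun _ hr =>
    norm_apply_sub_le hS h' hr fun _ hq => norm_apply_gen_le hS hTc hP hP1 hc hw h' hq

/-- The Chernoff-type estimate for the compressed semigroup. -/
theorem norm_pow_apply_sub_le (hT : IsC0Semigroup T) (hTc : ∀ t : ℝ, 0 ≤ t → ‖T t‖ ≤ 1)
    (hP1 : ‖P‖ ≤ 1) (hb : 0 ≤ b)
    (hPTQ : ∀ t : ℝ, 0 ≤ t → ‖P * T t * (1 - P)‖ ≤ t * b)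
    (hQTP : ∀ t : ℝ, 0 ≤ t → ‖(1 - P) * T t * P‖ ≤ t * b)
    (hP : P * P = P) (hS : IsC0Semigroup S) (hc : IsCompressedGen T S P) {v : X}
    (hu : P u = u) (hw : P w = w) (h : HasGen S u w) (h' : HasGen S w v) {t : ℝ} (ht : 0 ≤ t)
    (n : ℕ) :
    ‖((P * T t) ^ n) u - S (n * t) u‖
      ≤ n * (t ^ 2 / 2 * (b ^ 2 * ‖u‖ + b * ‖w‖ + 2 * ‖v‖)) := by
  induction n generalizing u w v with
  | zero => simp [hS.map_zero]
  | succ n ih =>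
    have hnt : 0 ≤ (n : ℝ) * t := by positivity
    have hPT : ‖P * T t‖ ≤ 1 := (norm_mul_le _ _).trans
      (mul_le_one₀ hP1 (norm_nonneg _) (hTc t ht))
    set u' := S (n * t) u with hu'
    have b1 : ‖u'‖ ≤ ‖u‖ := norm_apply_le_of_hasGen hS hTc hP hP1 hc hu h hnt
    have b2 : ‖S (n * t) w‖ ≤ ‖w‖ := norm_apply_le_of_hasGen hS hTc hP hP1 hc hw h' hnt
    have b3 : ‖S (n * t) v‖ ≤ ‖v‖ := norm_apply_gen_le hS hTc hP hP1 hc hw h' hnt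
    have p1 : P u' = u' := proj_apply_of_hasGen hS hP hc hu h hnt
    have p2 := proj_apply_of_hasGen hS hP hc hw h' hnt
    have g1 := h.apply hS hnt
    have g2 := h'.apply hS hnt
    have e1 := norm_proj_apply_sub_sub_le hT hTc hP1 hb hPTQ hQTP hP hc p1 g1 g2 ht
    have e2 := norm_compressed_apply_sub_sub_le hS hTc hP hP1 hc p2 g1 g2 ht
    have e3 : S ((n + 1 : ℕ) * t) u = S t u' := by
      rw [hu', ← apply_add hS ht hnt]; push_cast; ring_nf
    -- The contraction `P * T t` carries the old error; the new local error is the difference of two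
    -- Taylor remainders at `u'`. Each contributes one `‖v‖`, hence the factor 2.
    have e4 : ((P * T t) ^ (n + 1)) u - S t u' = (P * T t) (((P * T t) ^ n) u - u')
        + ((P (T t u') - u' - t • S (n * t) w) - (S t u' - u' - t • S (n * t) w)) := by
      rw [pow_succ', mul_apply_eq_comp (P * T t), map_sub, mul_apply_eq_comp P (T t) u']
      abel
    have e5 := ContinuousLinearMap.le_of_opNorm_le _ hPT (((P * T t) ^ n) u - u')
    have e6 := ih hu hw h h'
    have e7 : t ^ 2 / 2 * (b ^ 2 * ‖u'‖ + b * ‖S (n * t) w‖ + ‖S (n * t) v‖)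
        ≤ t ^ 2 / 2 * (b ^ 2 * ‖u‖ + b * ‖w‖ + ‖v‖) := by gcongr
    have e8 : t ^ 2 / 2 * ‖S (n * t) v‖ ≤ t ^ 2 / 2 * ‖v‖ := by gcongr
    rw [← hu'] at e2 e6
    rw [e3, e4, Nat.cast_succ]
    have e9 := norm_add_le ((P * T t) (((P * T t) ^ n) u - u'))
      ((P (T t u') - u' - t • S (n * t) w) - (S t u' - u' - t • S (n * t) w))
    have e10 := norm_sub_le (P (T t u') - u' - t • S (n * t) w) (S t u' - u' - t • S (n * t) w)
    linarith

end Projected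
end Zeno
namespace Zeno

/-! ### From powers of `N * U` to powers of `P * U`. -/

section Zeno

variable {X : Type*} [NormedAddCommGroup X] [NormedSpace ℂ X]

theorem isCompressedGen_of_isGeneratorOf {T S : ℝ → X →L[ℂ] X} {P : X →L[ℂ] X}
    (h : IsGeneratorOf (PLP (generator T) P) S) : IsCompressedGen T S P := by
  intro x z
  rw [hasGen_iff, ← h.2]
  constructor
  · rintro ⟨hx, rfl⟩
    obtain ⟨⟨_, hx1⟩, _⟩ := id hx
    exact ⟨_, tendsto_generator T ⟨P x, hx1⟩, rfl⟩
  · rintro ⟨y, hy, rfl⟩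
    obtain ⟨hx, rfl⟩ := hasGen_iff.1 hy
    exact ⟨⟨⟨trivial, hx⟩, trivial⟩, rfl⟩

theorem norm_pow_le_one {A : X →L[ℂ] X} (h : ‖A‖ ≤ 1) (m : ℕ) : ‖A ^ m‖ ≤ 1 := by
  induction m with
  | zero => exact ContinuousLinearMap.norm_id_le
  | succ m ih => exact (norm_mul_le _ _).trans (mul_le_one₀ ih (norm_nonneg _) h)

theorem norm_pow_le_pow {A : X →L[ℂ] X} {d : ℝ} (hd : 0 ≤ d) (h : ‖A‖ ≤ d) (m : ℕ) :
    ‖A ^ m‖ ≤ d ^ m := by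
  induction m with
  | zero => rw [pow_zero, pow_zero]; exact ContinuousLinearMap.norm_id_le
  | succ m ih =>
    rw [pow_succ, pow_succ]
    exact (norm_mul_le _ _).trans (by gcongr)

theorem norm_zeno_sub_le {N P U : X →L[ℂ] X} {d e : ℝ} (hN : ‖N‖ ≤ 1) (hP1 : ‖P‖ ≤ 1)
    (hU : ‖U‖ ≤ 1) (hP : P * P = P) (hNP : N * P = P) (hPN : P * N = P)
    (hd0 : 0 ≤ d) (hd1 : d < 1) (he : 0 ≤ e) (hd : ‖N - P‖ ≤ d)
    (hPUQ : ‖P * U * (1 - P)‖ ≤ e) (hQUP : ‖(1 - P) * U * P‖ ≤ e) {n : ℕ} (hn : 1 ≤ n) :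
    ‖(N * U) ^ n - (P * U) ^ n‖ ≤ (2 * e + n * e ^ 2) / (1 - d) + d ^ n := by
  have hd' : 0 < 1 - d := by linarith
  set A := P * U with hA
  set B := (N - P) * U with hB
  have hsum : A + B = N * U := by rw [hA, hB]; noncomm_ring
  have hBd : ‖B‖ ≤ d := (norm_mul_le _ _).trans
    ((mul_le_of_le_one_right (norm_nonneg _) hU).trans hd)
  have hRP : (N - P) * P = 0 := by rw [sub_mul, hNP, hP, sub_self]
  have hPR : P * (N - P) = 0 := by rw [mul_sub, hPN, hP, sub_self]
  have hQB : (1 - P) * B = B := by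
    rw [hB, ← mul_assoc, sub_mul 1 P (N - P), hPR, one_mul, sub_zero]
  have hBj : ∀ j, 1 ≤ j → (1 - P) * B ^ j = B ^ j := by
    intro j hj
    obtain ⟨i, rfl⟩ := Nat.exists_eq_add_of_le' hj
    rw [pow_succ', ← mul_assoc, hQB]
  have hPUB : ∀ j, 1 ≤ j → ∀ V, A * (B ^ j * V) = (P * U * (1 - P)) * (B ^ j * V) := by
    intro j hj V
    rw [hA, mul_assoc (P * U), ← mul_assoc (1 - P), hBj j hj]
  have hBA' : ‖B * A‖ ≤ d * e := by
    have : B * A = (N - P) * ((1 - P) * U * P) * U := by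
      have h1 : (N - P) * (1 - P) = N - P := by rw [mul_sub, hRP, mul_one, sub_zero]
      calc B * A = ((N - P) * (1 - P)) * U * (P * U) := by rw [h1]
        _ = _ := by noncomm_ring
    rw [this]
    calc _ ≤ ‖N - P‖ * ‖(1 - P) * U * P‖ * ‖U‖ := norm_mul₃_le
      _ ≤ d * e * 1 := by gcongr
      _ = _ := mul_one _
  have hBA : ∀ j : ℕ, 1 ≤ j → ‖B ^ j * A‖ ≤ d ^ j * e := by
    intro j hj
    obtain ⟨i, rfl⟩ := Nat.exists_eq_add_of_le' hj
    rw [pow_succ B, pow_succ d, mul_assoc, mul_assoc (d ^ i)]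
    exact (norm_mul_le _ _).trans (by gcongr; exact norm_pow_le_pow hd0 hBd i)
  have hABA : ∀ j : ℕ, 1 ≤ j → ‖A * (B ^ j * A)‖ ≤ e ^ 2 * d ^ j := by
    intro j hj
    rw [hPUB j hj]
    calc _ ≤ ‖P * U * (1 - P)‖ * ‖B ^ j * A‖ := norm_mul_le _ _
      _ ≤ e * (d ^ j * e) := by gcongr; exact hBA j hj
      _ = _ := by ring
  have hAB : ∀ j : ℕ, 1 ≤ j → ‖A * B ^ j‖ ≤ e * d ^ j := by
    intro j hj
    rw [← mul_one (B ^ j), hPUB j hj, mul_one]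
    exact (norm_mul_le _ _).trans (by gcongr; exact norm_pow_le_pow hd0 hBd j)
  have hNU : ‖A + B‖ ≤ 1 := hsum ▸ (norm_mul_le _ _).trans (mul_le_one₀ hN (norm_nonneg _) hU)
  have hA1 : ‖A‖ ≤ 1 := (norm_mul_le _ _).trans (mul_le_one₀ hP1 (norm_nonneg _) hU)
  obtain ⟨m, rfl⟩ := Nat.exists_eq_add_of_le' hn
  have key := norm_add_pow_mul_add_pow_sub_le hd0 hd1 (norm_pow_le_one hA1) (norm_pow_le_one hNU)
    hAB hBA hABA m 0 he
  rw [pow_zero, one_mul, hsum] at key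
  have h1 : e * ((1 - d ^ (m + 1)) / (1 - d)) ≤ e / (1 - d) := by
    rw [← mul_div_assoc]
    gcongr
    nlinarith [pow_nonneg hd0 (m + 1)]
  have h2 : e * (d ^ (0 + 1) / (1 - d)) ≤ e / (1 - d) := by
    rw [← mul_div_assoc]
    gcongr
    exact mul_le_of_le_one_right he (by simpa using hd1.le)
  have h3 : (m : ℝ) * (e ^ 2 / (1 - d)) ≤ ((m + 1 : ℕ) : ℝ) * e ^ 2 / (1 - d) := by
    rw [← mul_div_assoc]
    push_cast
    gcongr
    linarith
  have h4 := norm_pow_le_pow hd0 hBd (m + 1)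
  have h5 := norm_add_le ((N * U) ^ (m + 1) - A ^ (m + 1) - B ^ (m + 1)) (B ^ (m + 1))
  rw [sub_add_cancel] at h5
  rw [add_div, two_mul, add_div]
  linarith

theorem norm_pow_apply_sub_pow_apply_proj_le {P U : X →L[ℂ] X} {e : ℝ} (hP1 : ‖P‖ ≤ 1)
    (hU : ‖U‖ ≤ 1) (he : ‖P * U * (1 - P)‖ ≤ e) {n : ℕ} (hn : 1 ≤ n) (x : X) :
    ‖((P * U) ^ n) x - ((P * U) ^ n) (P x)‖ ≤ e * ‖x‖ := by
  obtain ⟨m, rfl⟩ := Nat.exists_eq_add_of_le' hn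
  have h1 : ((P * U) ^ (m + 1)) x - ((P * U) ^ (m + 1)) (P x)
      = ((P * U) ^ m) ((P * U * (1 - P)) x) := by
    rw [← map_sub, pow_succ, mul_apply_eq_comp, mul_apply_eq_comp (P * U) (1 - P)]
    rfl
  have h2 : ‖P * U‖ ≤ 1 := (norm_mul_le _ _).trans (mul_le_one₀ hP1 (norm_nonneg _) hU)
  rw [h1]
  have h3 := ContinuousLinearMap.le_of_opNorm_le _ (norm_pow_le_one h2 m) ((P * U * (1 - P)) x)
  have h4 := ContinuousLinearMap.le_of_opNorm_le _ he x
  linarith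

theorem tendsto_pow_of_norm_pow_sub_le {M P : X →L[ℂ] X} {c δ : ℝ} (hδ0 : 0 < δ) (hδ1 : δ < 1)
    (h : ∀ n : ℕ, 1 ≤ n → ‖M ^ n - P‖ ≤ c * δ ^ n) :
    Tendsto (fun n => M ^ n) atTop (𝓝 P) := by
  rw [tendsto_iff_norm_sub_tendsto_zero]
  have h1 : Tendsto (fun n : ℕ => c * δ ^ n) atTop (𝓝 0) := by
    simpa using (tendsto_pow_atTop_nhds_zero_of_lt_one hδ0.le hδ1).const_mul c
  refine squeeze_zero' (Eventually.of_forall fun n => norm_nonneg _) ?_ h1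
  filter_upwards [eventually_ge_atTop 1] with n hn using h n hn

/-- Multiplying by `M ^ k` only shifts the sequence of powers, which keeps its limit. -/
theorem pow_mul_eq_of_tendsto_pow {M P : X →L[ℂ] X} (h : Tendsto (fun n => M ^ n) atTop (𝓝 P))
    (k : ℕ) : M ^ k * P = P ∧ P * M ^ k = P := by
  have h1 := h.comp (tendsto_add_atTop_nat k)
  constructor
  · refine tendsto_nhds_unique (h.const_mul (M ^ k)) (h1.congr fun n => ?_)
    rw [← pow_add, add_comm]; rfl
  · refine tendsto_nhds_unique (h.mul_const (M ^ k)) (h1.congr fun n => ?_)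
    rw [← pow_add]; rfl

/-- The constant of the quantitative Zeno limit. -/
noncomputable def zenoConst (t b d : ℝ) : ℝ :=
  1 + |t * b| + (2 * |t * b| + (t * b) ^ 2) / |1 - d| + t ^ 2 / 2 * (b ^ 2 + |b| + 2)

theorem zenoConst_pos (t b d : ℝ) : 0 < zenoConst t b d := by
  unfold zenoConst; positivity

end Zeno

end Zeno

/-! ### Assembly of the Zeno estimate. -/

theorem mainTheorem8 :
    ∃ c : ℝ → ℝ → ℝ → ℝ, (∀ t b d : ℝ, 0 < c t b d) ∧
      ∀ (X : Type u) [NormedAddCommGroup X] [NormedSpace ℂ X] [CompleteSpace X]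
        (L : X →ₗ.[ℂ] X) (T : ℝ → X →L[ℂ] X) (M P : X →L[ℂ] X) (S : ℝ → X →L[ℂ] X)
        (c' δ b : ℝ),
        Zeno.IsGeneratorOf L T →
        (∀ t : ℝ, 0 ≤ t → ‖T t‖ ≤ 1) →
        ‖M‖ ≤ 1 →
        P * P = P →
        0 < δ → δ < 1 → 0 ≤ c' →
        (∀ n : ℕ, 1 ≤ n → ‖M ^ n - P‖ ≤ c' * δ ^ n) →
        0 ≤ b →
        (∀ t : ℝ, 0 ≤ t → ‖P * T t * (1 - P)‖ ≤ t * b ∧ ‖(1 - P) * T t * P‖ ≤ t * b) →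
        Zeno.IsGeneratorOf (Zeno.PLP L P) S →
        (∃ n₀ : ℕ, 1 ≤ n₀ ∧ c' * δ ^ n₀ < 1) ∧
        ∀ n₀ : ℕ, 1 ≤ n₀ → c' * δ ^ n₀ < 1 →
          ∀ t : ℝ, 0 ≤ t → ∀ n : ℕ, 1 ≤ n → ∀ x : (Zeno.LPsq L P).domain,
            ‖((M ^ n₀ * T (t / n)) ^ n) (x : X) - S t (P (x : X))‖ ≤
              c t b (c' * δ ^ n₀) / n *
                  (‖(x : X)‖ + ‖Zeno.LP L P ⟨x, Zeno.LPsq_domain_le L P x.2⟩‖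
                    + ‖Zeno.LPsq L P x‖)
                + (c' * δ ^ n₀) ^ n * ‖(x : X)‖ := by
  refine ⟨Zeno.zenoConst, Zeno.zenoConst_pos, ?_⟩
  intro X _ _ _ L T M P S c' δ b hL hTc hM hP hδ0 hδ1 hc' hMP hb hPT hS
  obtain ⟨hT, rfl⟩ := hL
  have hc := Zeno.isCompressedGen_of_isGeneratorOf hS
  have hS := hS.1
  have hlim := Zeno.tendsto_pow_of_norm_pow_sub_le hδ0 hδ1 hMP
  have hP1 : ‖P‖ ≤ 1 := le_of_tendsto' hlim.norm fun n => Zeno.norm_pow_le_one hM n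
  constructor
  · have h1 : Tendsto (fun n : ℕ => c' * δ ^ n) atTop (𝓝 0) := by
      simpa using (tendsto_pow_atTop_nhds_zero_of_lt_one hδ0.le hδ1).const_mul c'
    exact ((eventually_ge_atTop 1).and (h1.eventually (gt_mem_nhds one_pos))).exists
  intro n₀ hn₀ hd1 t ht n hn x
  obtain ⟨x, hx⟩ := x
  have hNd := hMP n₀ hn₀
  have hd0 : 0 ≤ c' * δ ^ n₀ := by positivity
  set d := c' * δ ^ n₀ with hd
  have hn0 : (0 : ℝ) < n := by exact_mod_cast hn
  have hs : 0 ≤ t / n := by positivity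
  obtain ⟨⟨_, hx1⟩, ⟨_, hx2⟩⟩ := id hx
  set y : X := Zeno.LP (Zeno.generator T) P ⟨x, Zeno.LPsq_domain_le _ P hx⟩ with hy
  set z : X := Zeno.LPsq (Zeno.generator T) P ⟨x, hx⟩ with hz
  have gy : Zeno.HasGen T (P x) y := Zeno.tendsto_generator T ⟨P x, hx1⟩
  have gz : Zeno.HasGen T (P y) z := Zeno.tendsto_generator T ⟨P y, hx2⟩
  have hPP : ∀ v, P (P v) = P v := fun v => by rw [← mul_apply_eq_comp, hP]
  -- `P * P = P` turns `x ∈ D((LP)²)` into two applications of the generator of `S` to `P x`, with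
  -- values `P y` and `P z`.
  have g1 : Zeno.HasGen S (P x) (P y) := (hc _ _).2 ⟨y, by rwa [hPP], rfl⟩
  have g2 : Zeno.HasGen S (P y) (P z) := (hc _ _).2 ⟨z, by rwa [hPP], rfl⟩
  have hPn : ∀ v, ‖P v‖ ≤ ‖v‖ := fun v => by
    simpa using ContinuousLinearMap.le_of_opNorm_le _ hP1 v
  obtain ⟨hNP, hPN⟩ := Zeno.pow_mul_eq_of_tendsto_pow hlim n₀
  have e1 := Zeno.norm_zeno_sub_le (Zeno.norm_pow_le_one hM n₀) hP1 (hTc _ hs) hP hNP hPN hd0 hd1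
    (by positivity) hNd (hPT _ hs).1 (hPT _ hs).2 hn
  have e2 := Zeno.norm_pow_apply_sub_pow_apply_proj_le hP1 (hTc _ hs) (hPT _ hs).1 hn x
  have e3 := Zeno.norm_pow_apply_sub_le hT hTc hP1 hb (fun r hr => (hPT r hr).1)
    (fun r hr => (hPT r hr).2) hP hS hc (hPP x) (hPP y) g1 g2 hs n
  rw [mul_div_cancel₀ t hn0.ne'] at e3
  have e1' := ContinuousLinearMap.le_of_opNorm_le _ e1 x
  rw [sub_apply] at e1'
  have e4 := norm_sub_le_norm_sub_add_norm_sub (((M ^ n₀ * T (t / n)) ^ n) x)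
    (((P * T (t / n)) ^ n) x) (S t (P x))
  have e5 := norm_sub_le_norm_sub_add_norm_sub (((P * T (t / n)) ^ n) x)
    (((P * T (t / n)) ^ n) (P x)) (S t (P x))
  have htb : 0 ≤ t * b := by positivity
  have hd' : 0 < 1 - d := by linarith
  set Y := ‖x‖ + ‖y‖ + ‖z‖ with hY
  have hxY : ‖x‖ ≤ Y := by rw [hY]; linarith [norm_nonneg y, norm_nonneg z]
  have e6 : b ^ 2 * ‖P x‖ + b * ‖P y‖ + 2 * ‖P z‖ ≤ (b ^ 2 + b + 2) * Y := by
    have h1 : b ^ 2 * ‖P x‖ + b * ‖P y‖ + 2 * ‖P z‖ ≤ b ^ 2 * Y + b * Y + 2 * Y := by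
      gcongr
      · exact (hPn x).trans hxY
      · exact (hPn y).trans (by rw [hY]; linarith [norm_nonneg x, norm_nonneg z])
      · exact (hPn z).trans (by rw [hY]; linarith [norm_nonneg x, norm_nonneg y])
    linarith
  have e7 : n * ((t / n) ^ 2 / 2 * (b ^ 2 * ‖P x‖ + b * ‖P y‖ + 2 * ‖P z‖))
      ≤ t ^ 2 / 2 * (b ^ 2 + b + 2) / n * Y :=
    calc _ ≤ n * ((t / n) ^ 2 / 2 * ((b ^ 2 + b + 2) * Y)) := by gcongr
      _ = _ := by field_simp
  have e8 : ((2 * (t / n * b) + n * (t / n * b) ^ 2) / (1 - d) + d ^ n) * ‖x‖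
      ≤ (2 * (t * b) + (t * b) ^ 2) / (1 - d) / n * Y + d ^ n * ‖x‖ :=
    calc _ = (2 * (t * b) + (t * b) ^ 2) / (1 - d) / n * ‖x‖ + d ^ n * ‖x‖ := by field_simp
      _ ≤ _ := by gcongr
  have e9 : t / n * b * ‖x‖ ≤ t * b / n * Y :=
    calc _ = t * b / n * ‖x‖ := by ring
      _ ≤ _ := by gcongr
  -- The summand 1 and the absolute values in `zenoConst` only secure positivity for all real
  -- arguments; here the former is slack and the latter drop out. The other terms match `e9`, `e8`
  -- and `e7`.
  have e10 : Zeno.zenoConst t b d / n * Y = 1 / n * Y + t * b / n * Y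
      + (2 * (t * b) + (t * b) ^ 2) / (1 - d) / n * Y + t ^ 2 / 2 * (b ^ 2 + b + 2) / n * Y := by
    rw [Zeno.zenoConst, abs_of_nonneg htb, abs_of_pos hd', abs_of_nonneg hb]
    ring
  have e11 : 0 ≤ 1 / (n : ℝ) * Y := by positivity
  rw [e10]
  linarith
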